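/- **Setting.** Consider the half-duplex Gaussian parallel relay channel with source $0$, relays $1,2$, destination $3$, no direct source–destination link, real channel coefficients $h_{01},h_{02},h_{12}=h_{21},h_{13},h_{23}$, and independent real Gaussian noises $Z$ of mean $0$ and variance $1$ at the receivers. It has four states: in state 1, $Y_1=h_{01}X_0+h_{12}X_2+Z_1$ and $Y_3=h_{23}X_2+Z_3$; in state 2, $Y_2=h_{02}X_0+h_{12}X_1+Z_2$ and $Y_3=h_{13}X_1+Z_3$; in state 3, $Y_1=h_{01}X_0+Z_1$ and $Y_2=h_{02}X_0+Z_2$; in state 4, $Y_3=h_{13}X_1+h_{23}X_2+Z_3$. The available powers of nodes $0,1,2$ are $P_0,P_1,P_2$. Signals and noises are independent, superscripts denote the state, and $C(x)=\frac12\log_2(1+x)$. **Cut-set bound.** $C^{up}(P_0,P_1,P_2)$ is the supremum, over all durations $\hat t_1,\dots,\hat t_4\ge 0$ with $\hat t_1+\hat t_2+\hat t_3+\hat t_4=1$ and all joint laws (with finite second moments) of the transmitted signals $(X_0^{(1)},X_2^{(1)})$, $(X_0^{(2)},X_1^{(2)})$, $X_0^{(3)}$, $(X_1^{(4)},X_2^{(4)})$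 that satisfy the power constraints $\sum_{b}\hat t_b\,E[(X_a^{(b)})^2]=P_a$ for $a=0,1,2$ (sum over the states $b$ in which node $a$ transmits), of the minimum of the four quantities $$\hat t_1 I(X_0^{(1)};Y_1^{(1)}|X_2^{(1)})+\hat t_2 I(X_0^{(2)};Y_2^{(2)}|X_1^{(2)})+\hat t_3 I(X_0^{(3)};Y_1^{(3)},Y_2^{(3)}),$$ $$\hat t_2 I(X_0^{(2)},X_1^{(2)};Y_2^{(2)},Y_3^{(2)})+\hat t_3 I(X_0^{(3)};Y_2^{(3)})+\hat t_4 I(X_1^{(4)};Y_3^{(4)}|X_2^{(4)}),$$ $$\hat t_1 I(X_0^{(1)},X_2^{(1)};Y_1^{(1)},Y_3^{(1)})+\hat t_3 I(X_0^{(3)};Y_1^{(3)})+\hat t_4 I(X_2^{(4)};Y_3^{(4)}|X_1^{(4)}),$$ $$\hat t_1 I(X_2^{(1)};Y_3^{(1)})+\hat t_2 I(X_1^{(2)};Y_3^{(2)})+\hat t_4 I(X_1^{(4)},X_2^{(4)};Y_3^{(4)}),$$ where (conditional) mutual information is measured in bits. **DDF rate.** For $h_{01}\ge h_{02}\ge 0$,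 the rate $C_{DDF}^{low}(P_0,P_1,P_2)$ of simultaneous relaying with dynamic decode-and-forward is the supremum of $R_p+R_c$ (private plus common rate) over all nonnegative $t_3,t_4,P_{0,p},P_{0,c},P_{1,p},P_{1,c},R_p,R_c$ with $t_3+t_4=1$, $P_{0,p}+P_{0,c}=P_0$, $P_{1,p}+P_{1,c}=P_1$, $$R_p\le\min\Big(t_3C\big(\tfrac{h_{01}^2P_{0,p}}{t_3}\big),\,t_4C\big(\tfrac{h_{13}^2P_{1,p}}{t_4}\big)\Big),\qquad R_c\le t_3C\Big(\tfrac{h_{02}^2P_{0,c}}{t_3+h_{02}^2P_{0,p}}\Big),$$ $$R_p+R_c\le t_4C\Big(\tfrac{h_{13}^2P_{1,p}+(h_{13}\sqrt{P_{1,c}}+h_{23}\sqrt{P_2})^2}{t_4}\Big),$$ where an expression of the form $tC(a/t)$ or $tC(\frac{a}{t+b})$ is read as $0$ at $t=0$. **Theorem.** Let $h_{01}\ge h_{02}\ge0$, $h_{13},h_{23}\ge0$, and let $\gamma_1,\gamma_2\ge0$ be constants with $$0<\big(h_{13}\sqrt{\gamma_1}+h_{23}\sqrt{\gamma_2}\big)^2\le\min(h_{01}^2,h_{02}^2).$$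 Put $P_1=\gamma_1P_0$ and $P_2=\gamma_2P_0$. Then $$\lim_{P_0\to0^+}\frac{C_{DDF}^{low}(P_0,\gamma_1P_0,\gamma_2P_0)}{C^{up}(P_0,\gamma_1P_0,\gamma_2P_0)}=1.$$ The same limit holds when $C_{DDF}^{low}$ is replaced by the largest DDF rate under the additional restrictions $t_3=t_4=\frac12$ and $R_p=P_{0,p}=P_{1,p}=0$ (only a common message is sent). -/

import Mathlib

open MeasureTheory ProbabilityTheory InformationTheory Filter Topology
open scoped ENNReal

noncomputable section

/-- Mutual information `I(X; Y)` in bits: the Kullback-Leibler divergence of the joint law from the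
product of the marginal laws (Mathlib's `klDiv` is in nats). -/
def mutualInfo {Ω α β : Type*} [MeasurableSpace Ω] [MeasurableSpace α] [MeasurableSpace β]
    (P : Measure Ω) (X : Ω → α) (Y : Ω → β) : ℝ≥0∞ :=
  klDiv (P.map (fun ω => (X ω, Y ω))) ((P.map X).prod (P.map Y)) / ENNReal.ofReal (Real.log 2)

/-- Conditional mutual information `I(X; Y | Z)` in bits: the Kullback-Leibler divergence of the law
of `(Z, X, Y)` from the law that has the same `(Z, X)` and `(Z, Y)` marginals and makes `X` and `Y`
conditionally independent given `Z`. -/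
def condMutualInfo {Ω α β γ : Type*} [MeasurableSpace Ω]
    [MeasurableSpace α] [StandardBorelSpace α] [Nonempty α]
    [MeasurableSpace β] [StandardBorelSpace β] [Nonempty β] [MeasurableSpace γ]
    (P : Measure Ω) [IsFiniteMeasure P] (X : Ω → α) (Y : Ω → β) (Z : Ω → γ) : ℝ≥0∞ :=
  klDiv (P.map (fun ω => (Z ω, (X ω, Y ω))))
    ((P.map Z) ⊗ₘ ((condDistrib X Z P) ×ₖ (condDistrib Y Z P))) / ENNReal.ofReal (Real.log 2)

/-- The Gaussian capacity function `C(x) = (1/2) log₂ (1 + x)`. -/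
def gaussC (x : ℝ) : ℝ := 1 / 2 * Real.logb 2 (1 + x)

/-- Channel coefficients of the parallel relay network. Node `0` is the source, nodes `1`, `2` are
the relays, node `3` is the destination; the link between the relays is reciprocal. -/
structure Gains where
  h01 : ℝ
  h02 : ℝ
  h12 : ℝ
  h13 : ℝ
  h23 : ℝ

/-- Powers available at the source and at the two relays. -/
structure Powers where
  P0 : ℝ
  P1 : ℝ
  P2 : ℝ

/-! ### The rate of dynamic decode-and-forward (simultaneous relaying) -/

/-- Parameters of the Gaussian DDF scheme: durations of the broadcast slot (`t3`) and of the
multiple access slot (`t4`), private and common powers of the source and of relay 1, and the rates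
of the private and of the common message. -/
structure DDFParams where
  t3 : ℝ
  t4 : ℝ
  P0p : ℝ
  P0c : ℝ
  P1p : ℝ
  P1c : ℝ
  Rp : ℝ
  Rc : ℝ

/-- The constraints on the parameters of the Gaussian DDF scheme (relay 1 is the relay with the
better channel from the source). An expression `t * gaussC (a / t)` is `0` at `t = 0`. -/
structure DDFFeasible (g : Gains) (P : Powers) (p : DDFParams) : Prop where
  t3_nonneg : 0 ≤ p.t3
  t4_nonneg : 0 ≤ p.t4
  time : p.t3 + p.t4 = 1
  P0p_nonneg : 0 ≤ p.P0p
  P0c_nonneg : 0 ≤ p.P0c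
  power0 : p.P0p + p.P0c = P.P0
  P1p_nonneg : 0 ≤ p.P1p
  P1c_nonneg : 0 ≤ p.P1c
  power1 : p.P1p + p.P1c = P.P1
  Rp_nonneg : 0 ≤ p.Rp
  Rc_nonneg : 0 ≤ p.Rc
  private_rate : p.Rp ≤ min (p.t3 * gaussC (g.h01 ^ 2 * p.P0p / p.t3))
    (p.t4 * gaussC (g.h13 ^ 2 * p.P1p / p.t4))
  common_rate : p.Rc ≤ p.t3 * gaussC (g.h02 ^ 2 * p.P0c / (p.t3 + g.h02 ^ 2 * p.P0p))
  sum_rate : p.Rp + p.Rc ≤ p.t4 * gaussC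
    ((g.h13 ^ 2 * p.P1p + (g.h13 * √p.P1c + g.h23 * √P.P2) ^ 2) / p.t4)

/-- The DDF rate: the largest total rate over all the parameters of the scheme. -/
def ddfRate (g : Gains) (P : Powers) : ℝ :=
  sSup {R | ∃ p : DDFParams, DDFFeasible g P p ∧ R = p.Rp + p.Rc}

/-- The largest rate of the DDF scheme when the two slots have duration `1/2` and no private
message is sent: it has rate zero, and neither the source nor relay 1 spends power on it. -/
def ddfCommonHalfRate (g : Gains) (P : Powers) : ℝ :=
  sSup {R | ∃ p : DDFParams, DDFFeasible g P p ∧ p.t3 = 1 / 2 ∧ p.t4 = 1 / 2 ∧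
    p.Rp = 0 ∧ p.P0p = 0 ∧ p.P1p = 0 ∧ R = p.Rp + p.Rc}

/-! ### The cut-set upper bound

The network has four states. State 1: nodes 0 and 2 send, nodes 1 and 3 receive. State 2: nodes 0
and 1 send, nodes 2 and 3 receive. State 3: node 0 sends, nodes 1 and 2 receive. State 4: nodes 1
and 2 send, node 3 receives. -/

/-- The law of independent real noises of mean `0` and variance `1` at two receivers. -/
abbrev noise₂ : Measure (ℝ × ℝ) := (gaussianReal 0 1).prod (gaussianReal 0 1)

/-- Durations of the four states, and in each state the joint law of the transmitted signals:
of `(X0, X2)` in state 1, of `(X0, X1)` in state 2, of `X0` in state 3, of `(X1, X2)` in state 4. -/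
structure CutSetInput where
  t1 : ℝ
  t2 : ℝ
  t3 : ℝ
  t4 : ℝ
  law1 : ProbabilityMeasure (ℝ × ℝ)
  law2 : ProbabilityMeasure (ℝ × ℝ)
  law3 : ProbabilityMeasure ℝ
  law4 : ProbabilityMeasure (ℝ × ℝ)

namespace CutSetInput

/-- Constraints on the durations and on the powers. A node whose signal has second moment `v` during
a state of duration `t` spends the power `t * v` in that state. -/
structure Admissible (P : Powers) (q : CutSetInput) : Prop where
  t1_nonneg : 0 ≤ q.t1
  t2_nonneg : 0 ≤ q.t2
  t3_nonneg : 0 ≤ q.t3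
  t4_nonneg : 0 ≤ q.t4
  time : q.t1 + q.t2 + q.t3 + q.t4 = 1
  integrable1 : Integrable (fun x => x.1 ^ 2) (q.law1 : Measure (ℝ × ℝ)) ∧
    Integrable (fun x => x.2 ^ 2) (q.law1 : Measure (ℝ × ℝ))
  integrable2 : Integrable (fun x => x.1 ^ 2) (q.law2 : Measure (ℝ × ℝ)) ∧
    Integrable (fun x => x.2 ^ 2) (q.law2 : Measure (ℝ × ℝ))
  integrable3 : Integrable (fun x => x ^ 2) (q.law3 : Measure ℝ)
  integrable4 : Integrable (fun x => x.1 ^ 2) (q.law4 : Measure (ℝ × ℝ)) ∧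
    Integrable (fun x => x.2 ^ 2) (q.law4 : Measure (ℝ × ℝ))
  power0 : q.t1 * (∫ x, x.1 ^ 2 ∂(q.law1 : Measure (ℝ × ℝ))) +
    q.t2 * (∫ x, x.1 ^ 2 ∂(q.law2 : Measure (ℝ × ℝ))) +
    q.t3 * (∫ x, x ^ 2 ∂(q.law3 : Measure ℝ)) = P.P0
  power1 : q.t2 * (∫ x, x.2 ^ 2 ∂(q.law2 : Measure (ℝ × ℝ))) +
    q.t4 * (∫ x, x.1 ^ 2 ∂(q.law4 : Measure (ℝ × ℝ))) = P.P1
  power2 : q.t1 * (∫ x, x.2 ^ 2 ∂(q.law1 : Measure (ℝ × ℝ))) +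
    q.t4 * (∫ x, x.2 ^ 2 ∂(q.law4 : Measure (ℝ × ℝ))) = P.P2

/-- State 1: the law of the outcome `((x0, x2), (z1, z3))`. -/
abbrev prob1 (q : CutSetInput) : Measure ((ℝ × ℝ) × (ℝ × ℝ)) :=
  (q.law1 : Measure (ℝ × ℝ)).prod noise₂

/-- State 2: the law of the outcome `((x0, x1), (z2, z3))`. -/
abbrev prob2 (q : CutSetInput) : Measure ((ℝ × ℝ) × (ℝ × ℝ)) :=
  (q.law2 : Measure (ℝ × ℝ)).prod noise₂

/-- State 3: the law of the outcome `(x0, (z1, z2))`. -/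
abbrev prob3 (q : CutSetInput) : Measure (ℝ × (ℝ × ℝ)) :=
  (q.law3 : Measure ℝ).prod noise₂

/-- State 4: the law of the outcome `((x1, x2), z3)`. -/
abbrev prob4 (q : CutSetInput) : Measure ((ℝ × ℝ) × ℝ) :=
  (q.law4 : Measure (ℝ × ℝ)).prod (gaussianReal 0 1)

end CutSetInput

/-- Signals received in state 1 by nodes 1 and 3. -/
def Gains.y11 (g : Gains) (ω : (ℝ × ℝ) × (ℝ × ℝ)) : ℝ :=
  g.h01 * ω.1.1 + g.h12 * ω.1.2 + ω.2.1

def Gains.y13 (g : Gains) (ω : (ℝ × ℝ) × (ℝ × ℝ)) : ℝ := g.h23 * ω.1.2 + ω.2.2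

/-- Signals received in state 2 by nodes 2 and 3. -/
def Gains.y22 (g : Gains) (ω : (ℝ × ℝ) × (ℝ × ℝ)) : ℝ :=
  g.h02 * ω.1.1 + g.h12 * ω.1.2 + ω.2.1

def Gains.y23 (g : Gains) (ω : (ℝ × ℝ) × (ℝ × ℝ)) : ℝ := g.h13 * ω.1.2 + ω.2.2

/-- Signals received in state 3 by nodes 1 and 2. -/
def Gains.y31 (g : Gains) (ω : ℝ × (ℝ × ℝ)) : ℝ := g.h01 * ω.1 + ω.2.1

def Gains.y32 (g : Gains) (ω : ℝ × (ℝ × ℝ)) : ℝ := g.h02 * ω.1 + ω.2.2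

/-- Signal received in state 4 by node 3. -/
def Gains.y43 (g : Gains) (ω : (ℝ × ℝ) × ℝ) : ℝ := g.h13 * ω.1.1 + g.h23 * ω.1.2 + ω.2

namespace CutSetInput

/-- Information across the cut `{0} | {1, 2, 3}`. -/
def cut0 (g : Gains) (q : CutSetInput) : ℝ≥0∞ :=
  ENNReal.ofReal q.t1 * condMutualInfo q.prob1 (fun ω => ω.1.1) g.y11 (fun ω => ω.1.2) +
  ENNReal.ofReal q.t2 * condMutualInfo q.prob2 (fun ω => ω.1.1) g.y22 (fun ω => ω.1.2) +
  ENNReal.ofReal q.t3 * mutualInfo q.prob3 (fun ω => ω.1) (fun ω => (g.y31 ω, g.y32 ω))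

/-- Information across the cut `{0, 1} | {2, 3}`. -/
def cut01 (g : Gains) (q : CutSetInput) : ℝ≥0∞ :=
  ENNReal.ofReal q.t2 * mutualInfo q.prob2 (fun ω => ω.1) (fun ω => (g.y22 ω, g.y23 ω)) +
  ENNReal.ofReal q.t3 * mutualInfo q.prob3 (fun ω => ω.1) g.y32 +
  ENNReal.ofReal q.t4 * condMutualInfo q.prob4 (fun ω => ω.1.1) g.y43 (fun ω => ω.1.2)

/-- Information across the cut `{0, 2} | {1, 3}`. -/
def cut02 (g : Gains) (q : CutSetInput) : ℝ≥0∞ :=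
  ENNReal.ofReal q.t1 * mutualInfo q.prob1 (fun ω => ω.1) (fun ω => (g.y11 ω, g.y13 ω)) +
  ENNReal.ofReal q.t3 * mutualInfo q.prob3 (fun ω => ω.1) g.y31 +
  ENNReal.ofReal q.t4 * condMutualInfo q.prob4 (fun ω => ω.1.2) g.y43 (fun ω => ω.1.1)

/-- Information across the cut `{0, 1, 2} | {3}`. -/
def cut012 (g : Gains) (q : CutSetInput) : ℝ≥0∞ :=
  ENNReal.ofReal q.t1 * mutualInfo q.prob1 (fun ω => ω.1.2) g.y13 +
  ENNReal.ofReal q.t2 * mutualInfo q.prob2 (fun ω => ω.1.2) g.y23 +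
  ENNReal.ofReal q.t4 * mutualInfo q.prob4 (fun ω => ω.1) g.y43

end CutSetInput

/-- The cut-set upper bound of the half-duplex Gaussian parallel relay channel: the supremum, over
all the durations of the states and all the input laws that satisfy the power constraints, of the
least information across the four cuts. -/
def cutSetBound (g : Gains) (P : Powers) : ℝ≥0∞ :=
  ⨆ (q : CutSetInput) (_ : q.Admissible P),
    min (min (q.cut0 g) (q.cut01 g)) (min (q.cut02 g) (q.cut012 g))

end

/-! At low power, `log (1 + x) ~ x`: rate is received energy over `2 log 2`, however that energy is
spread over time. Write `x = S * P₀` with `S = (h13 √γ₁ + h23 √γ₂)²`, the energy reaching the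
destination when the relays transmit fully coherently. All three quantities are shown to lie between
`x / (2 log 2) * (1 - 2x)` and `x / (2 log 2)`, so both ratios tend to 1.

Upper bounds: the final hop alone suffices. Unit Gaussian noise passes at most half the signal power
in nats (`mutualInfo_add_noise_le`), and by Cauchy-Schwarz no split of the relay powers beats full
coherence (`coherent_power_split_le`).

Lower bounds: use half of the time to broadcast and half for coherent relaying. Since `S ≤ min
(h01²) (h02²)`, the broadcast is not a bottleneck. For the cut-set bound, antipodal inputs suffice:
the Donsker-Varadhan inequality with a bilinear test function gives their information to first order
(`le_mutualInfo_add_noise_twoPoint`). -/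

/-! ### Divergence inequalities and the Gaussian shift -/

/-- The Donsker-Varadhan lower bound on the Kullback-Leibler divergence. -/
lemma ofReal_integral_sub_log_integral_exp_le_klDiv {α : Type*} [MeasurableSpace α]
    {μ ν : Measure α} [IsProbabilityMeasure μ] [IsProbabilityMeasure ν] {f : α → ℝ}
    (hfμ : Integrable f μ) (hfν : Integrable (fun x => Real.exp (f x)) ν) :
    ENNReal.ofReal (∫ x, f x ∂μ - Real.log (∫ x, Real.exp (f x) ∂ν)) ≤ klDiv μ ν := by
  by_cases hac : μ ≪ ν
  swap; · simp [hac]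
  by_cases hint : Integrable (llr μ ν) μ
  swap; · simp [klDiv_of_not_integrable hint]
  have : IsProbabilityMeasure (ν.tilted f) := isProbabilityMeasure_tilted hfν
  -- Divergence of `μ` from `ν` tilted by `f` is nonnegative; expanding its log-likelihood ratio
  -- gives the bound.
  have hnn := integral_llr_add_sub_measure_univ_nonneg
    (hac.trans (absolutelyContinuous_tilted hfν)) (integrable_llr_tilted_right hac hfμ hint hfν)
  rw [integral_llr_tilted_right hac hfμ hfν hint] at hnn
  rw [klDiv_of_ac_of_integrable hac hint]
  apply ENNReal.ofReal_le_ofReal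
  simp only [probReal_univ] at hnn ⊢
  linarith

/-- The divergence of a joint law from the product of its marginals is at most the divergence from
any product law with the same first marginal. -/
lemma klDiv_prod_marginals_le {α : Type*} [MeasurableSpace α] [StandardBorelSpace α] [Nonempty α]
    (μ : Measure (α × ℝ)) [IsProbabilityMeasure μ] (Q : Measure ℝ) [IsProbabilityMeasure Q] :
    klDiv μ (μ.fst.prod μ.snd) ≤ klDiv μ (μ.fst.prod Q) := by
  -- The chain rule splits off the first coordinate, but here the second marginal varies, so the
  -- coordinates are swapped.
  have key : ∀ (μ₁ μ₂ : Measure (α × ℝ)) [IsFiniteMeasure μ₁] [IsFiniteMeasure μ₂],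
      klDiv (μ₁.map Prod.swap) (μ₂.map Prod.swap) = klDiv μ₁ μ₂ := by
    intro μ₁ μ₂ _ _
    apply le_antisymm (klDiv_map_le _ _ measurable_swap)
    have h := klDiv_map_le (μ₁.map Prod.swap) (μ₂.map Prod.swap)
      (measurable_swap : Measurable (Prod.swap : ℝ × α → α × ℝ))
    simpa [Measure.map_map measurable_swap measurable_swap] using h
  rw [← key μ, ← key μ (μ.fst.prod Q), Measure.prod_swap, Measure.prod_swap]
  have hd : μ.map Prod.swap = μ.snd ⊗ₘ (μ.map Prod.swap).condKernel := by
    conv_lhs => rw [← Measure.disintegrate (μ.map Prod.swap) (μ.map Prod.swap).condKernel]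
    simp
  -- The chain rule makes the excess exactly `klDiv μ.snd Q`.
  rw [hd, ← Measure.compProd_const, ← Measure.compProd_const,
    klDiv_compProd_eq_add (μ.snd) Q _ (Kernel.const ℝ μ.fst)]
  exact le_add_self

/-- A unit Gaussian law shifted by `m` is a tilt of the centred one. -/
lemma gaussianReal_map_const_add_eq_withDensity (m : ℝ) :
    (gaussianReal 0 1).map (fun z => m + z) =
      (gaussianReal 0 1).withDensity (fun y => ENNReal.ofReal (Real.exp (m * y - m ^ 2 / 2))) := by
  rw [gaussianReal_map_const_add, gaussianReal_of_var_ne_zero _ one_ne_zero,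
    gaussianReal_of_var_ne_zero _ one_ne_zero, ← withDensity_mul _ (by fun_prop) (by fun_prop)]
  congr 1
  ext y
  simp only [gaussianPDF, Pi.mul_apply, gaussianPDFReal]
  rw [← ENNReal.ofReal_mul (by positivity), mul_assoc (_⁻¹), ← Real.exp_add]
  congr 3
  push_cast
  ring

lemma memLp_two_id_gaussianReal : MemLp (fun z : ℝ => z) 2 (gaussianReal 0 1) :=
  memLp_id_gaussianReal' 2 (by simp)

/-! ### Information through additive unit Gaussian noise -/

section AdditiveNoise

variable {α : Type*} [MeasurableSpace α]

/-- The joint law of a signal and of its noisy observation, as a measure with density with respect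
to the law of independent signal and noise. -/
lemma map_add_noise_eq_withDensity (L : Measure α) [IsProbabilityMeasure L] {s : α → ℝ}
    (hs : Measurable s) :
    (L.prod (gaussianReal 0 1)).map (fun p => (p.1, s p.1 + p.2)) =
      (L.prod (gaussianReal 0 1)).withDensity
        (fun p => ENNReal.ofReal (Real.exp (s p.1 * p.2 - s p.1 ^ 2 / 2))) := by
  apply Measure.ext_of_lintegral
  intro f hf
  rw [lintegral_map hf (by fun_prop), lintegral_prod _ (by fun_prop),
    lintegral_withDensity_eq_lintegral_mul _ (by fun_prop) hf, lintegral_prod _ (by fun_prop)]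
  congr 1
  ext x
  have h1 : ∫⁻ z, f (x, s x + z) ∂gaussianReal 0 1 =
      ∫⁻ y, f (x, y) ∂((gaussianReal 0 1).map (fun z => s x + z)) := by
    rw [lintegral_map (by fun_prop) (by fun_prop)]
  rw [h1, gaussianReal_map_const_add_eq_withDensity,
    lintegral_withDensity_eq_lintegral_mul _ (by fun_prop) (by fun_prop)]
  rfl

/-- The log-likelihood ratio is `s y - s² / 2`. With `y = s + z` it becomes `s z + s² / 2`, and the
cross term has mean zero because the noise is centred and independent of the signal. -/
lemma klDiv_map_add_noise_le (L : Measure α) [IsProbabilityMeasure L] {s : α → ℝ}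
    (hs : Measurable s) (hs2 : Integrable (fun x => s x ^ 2) L) :
    klDiv ((L.prod (gaussianReal 0 1)).map (fun p => (p.1, s p.1 + p.2)))
      (L.prod (gaussianReal 0 1)) ≤ ENNReal.ofReal ((∫ x, s x ^ 2 ∂L) / 2) := by
  set ρ := L.prod (gaussianReal 0 1)
  set μ := ρ.map (fun p => (p.1, s p.1 + p.2)) with hμ
  have hprob : IsProbabilityMeasure μ := Measure.isProbabilityMeasure_map (by fun_prop)
  have hd := map_add_noise_eq_withDensity L hs
  have hac : μ ≪ ρ := by rw [hμ, hd]; exact withDensity_absolutelyContinuous _ _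
  have hllr : llr μ ρ =ᵐ[μ] fun p => s p.1 * p.2 - s p.1 ^ 2 / 2 := by
    apply hac.ae_le
    have h := Measure.rnDeriv_withDensity ρ (f := fun p : α × ℝ =>
      ENNReal.ofReal (Real.exp (s p.1 * p.2 - s p.1 ^ 2 / 2))) (by fun_prop)
    rw [← hd, ← hμ] at h
    filter_upwards [h] with p hp
    rw [llr, hp, ENNReal.toReal_ofReal (Real.exp_pos _).le, Real.log_exp]
  have hsL : MemLp s 2 L := (memLp_two_iff_integrable_sq hs.aestronglyMeasurable).2 hs2
  have hi1 : Integrable (fun p : α × ℝ => s p.1 * p.2) ρ :=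
    (hsL.integrable one_le_two).mul_prod (memLp_two_id_gaussianReal.integrable one_le_two)
  have hi2 : Integrable (fun p : α × ℝ => s p.1 ^ 2 / 2) ρ := (hs2.div_const 2).comp_fst _
  have hcomp : (fun p : α × ℝ => s p.1 * p.2 - s p.1 ^ 2 / 2) ∘ (fun p : α × ℝ => (p.1, s p.1 + p.2)) =
      fun p : α × ℝ => s p.1 * p.2 + s p.1 ^ 2 / 2 := by
    ext p; simp only [Function.comp]; ring
  have hint : Integrable (fun p : α × ℝ => s p.1 * p.2 - s p.1 ^ 2 / 2) μ := by
    rw [hμ, integrable_map_measure (by fun_prop) (by fun_prop), hcomp]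
    exact hi1.add hi2
  rw [klDiv_of_ac_of_integrable hac ((integrable_congr hllr).2 hint), integral_congr_ae hllr, hμ,
    integral_map (by fun_prop) (by fun_prop)]
  apply le_of_eq
  congr 1
  have h3 : ∫ p : α × ℝ, s p.1 * p.2 ∂ρ = 0 := by
    rw [integral_prod_mul (μ := L) (ν := gaussianReal 0 1) s (fun z => z), integral_id_gaussianReal,
      mul_zero]
  have h4 : ∫ p : α × ℝ, s p.1 ^ 2 / 2 ∂ρ = (∫ x, s x ^ 2 ∂L) / 2 := by
    rw [integral_fun_fst (f := fun x => s x ^ 2 / 2), integral_div]; simp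
  simp only [probReal_univ, add_sub_cancel_right]
  calc _ = ∫ p : α × ℝ, (s p.1 * p.2 + s p.1 ^ 2 / 2) ∂ρ := by
        congr 1
    _ = _ := by rw [integral_add hi1 hi2, h3, h4, zero_add]

variable {Ω : Type*} [MeasurableSpace Ω] {P : Measure Ω} {X : Ω → α} {Z : Ω → ℝ}

/-- Mutual information of a signal and of its noisy observation in terms of the laws. -/
lemma mutualInfo_add_noise_eq (L : Measure α) [IsProbabilityMeasure L] {s : α → ℝ}
    (hs : Measurable s) (hX : Measurable X) (hZ : Measurable Z)
    (hlaw : P.map (fun ω => (X ω, Z ω)) = L.prod (gaussianReal 0 1)) :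
    mutualInfo P X (fun ω => s (X ω) + Z ω) =
      klDiv ((L.prod (gaussianReal 0 1)).map (fun p => (p.1, s p.1 + p.2)))
        (L.prod ((L.prod (gaussianReal 0 1)).map (fun p => s p.1 + p.2))) /
          ENNReal.ofReal (Real.log 2) := by
  have h1 : P.map X = L := by
    have h := congrArg (Measure.map Prod.fst) hlaw
    rw [Measure.map_map (by fun_prop) (by fun_prop)] at h
    simpa [Function.comp_def] using h
  rw [mutualInfo, h1, ← hlaw, Measure.map_map (by fun_prop) (by fun_prop),
    Measure.map_map (by fun_prop) (by fun_prop)]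
  rfl

/-- The information that passes an additive unit Gaussian noise is at most half of the signal
power, in nats. -/
lemma mutualInfo_add_noise_le [StandardBorelSpace α] [Nonempty α]
    (L : Measure α) [IsProbabilityMeasure L] {s : α → ℝ}
    (hs : Measurable s) (hs2 : Integrable (fun x => s x ^ 2) L) (hX : Measurable X)
    (hZ : Measurable Z) (hlaw : P.map (fun ω => (X ω, Z ω)) = L.prod (gaussianReal 0 1)) :
    mutualInfo P X (fun ω => s (X ω) + Z ω) ≤
      ENNReal.ofReal ((∫ x, s x ^ 2 ∂L) / 2) / ENNReal.ofReal (Real.log 2) := by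
  rw [mutualInfo_add_noise_eq L hs hX hZ hlaw]
  gcongr
  -- The true output law is the optimal second factor, so the pure noise law may replace it.
  refine le_trans ?_ (klDiv_map_add_noise_le L hs hs2)
  set μ := (L.prod (gaussianReal 0 1)).map (fun p => (p.1, s p.1 + p.2)) with hμ
  have : IsProbabilityMeasure μ := Measure.isProbabilityMeasure_map (by fun_prop)
  have hf : μ.fst = L := by
    rw [Measure.fst, hμ, Measure.map_map (by fun_prop) (by fun_prop)]
    exact Measure.fst_prod
  have hsnd : μ.snd = (L.prod (gaussianReal 0 1)).map (fun p => s p.1 + p.2) := by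
    rw [Measure.snd, hμ, Measure.map_map (by fun_prop) (by fun_prop)]
    rfl
  have h := klDiv_prod_marginals_le μ (gaussianReal 0 1)
  rwa [hf, hsnd] at h

/-- The law of a variable that takes two values with probability `1/2` each. -/
noncomputable def twoPoint (a b : α) : Measure α := (2⁻¹ : ℝ≥0∞) • (Measure.dirac a + Measure.dirac b)

instance isProbabilityMeasure_twoPoint (a b : α) : IsProbabilityMeasure (twoPoint a b) :=
  ⟨by simp [twoPoint, ENNReal.inv_two_add_inv_two]⟩

lemma lintegral_twoPoint (a b : α) {f : α → ℝ≥0∞} (hf : Measurable f) :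
    ∫⁻ x, f x ∂twoPoint a b = 2⁻¹ * (f a + f b) := by
  rw [twoPoint, lintegral_smul_measure, lintegral_add_measure, lintegral_dirac' _ hf,
    lintegral_dirac' _ hf, smul_eq_mul]

lemma integrable_twoPoint [MeasurableSingletonClass α] (a b : α) (f : α → ℝ) :
    Integrable f (twoPoint a b) :=
  ((integrable_dirac (by simp)).add_measure (integrable_dirac (by simp))).smul_measure (by simp)

lemma integral_twoPoint [MeasurableSingletonClass α] (a b : α) (f : α → ℝ) :
    ∫ x, f x ∂twoPoint a b = (f a + f b) / 2 := by
  rw [twoPoint, integral_smul_measure,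
    integral_add_measure (integrable_dirac (by simp)) (integrable_dirac (by simp)),
    integral_dirac, integral_dirac]
  simp
  ring

/-- Antipodal signalling achieves half of the signal power, in nats, up to the second order. -/
lemma le_mutualInfo_add_noise_twoPoint [MeasurableSingletonClass α] {a b : α} {s : α → ℝ} {c : ℝ}
    (hs : Measurable s) (ha : s a = c) (hb : s b = -c) (hX : Measurable X) (hZ : Measurable Z)
    (hlaw : P.map (fun ω => (X ω, Z ω)) = (twoPoint a b).prod (gaussianReal 0 1)) :
    ENNReal.ofReal (c ^ 2 / 2 - c ^ 4 / 2) / ENNReal.ofReal (Real.log 2) ≤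
      mutualInfo P X (fun ω => s (X ω) + Z ω) := by
  rw [mutualInfo_add_noise_eq _ hs hX hZ hlaw]
  gcongr
  set L := twoPoint a b
  set ρ := L.prod (gaussianReal 0 1)
  have : IsProbabilityMeasure (ρ.map (fun p => (p.1, s p.1 + p.2))) :=
    Measure.isProbabilityMeasure_map (by fun_prop)
  have : IsProbabilityMeasure (ρ.map (fun p => s p.1 + p.2)) :=
    Measure.isProbabilityMeasure_map (by fun_prop)
  have hi1 : Integrable (fun p : α × ℝ => s p.1 * p.2) ρ :=
    (integrable_twoPoint a b s).mul_prod (memLp_two_id_gaussianReal.integrable one_le_two)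
  have hi2 : Integrable (fun p : α × ℝ => s p.1 ^ 2) ρ :=
    (integrable_twoPoint a b (fun x => s x ^ 2)).comp_fst _
  have hcomp : (fun p : α × ℝ => s p.1 * p.2) ∘ (fun p : α × ℝ => (p.1, s p.1 + p.2)) =
      fun p : α × ℝ => s p.1 * p.2 + s p.1 ^ 2 := by
    ext p; simp only [Function.comp]; ring
  -- The test function is `s(x) y`. The remaining part `-s² / 2` of the log-likelihood ratio is
  -- constant on the two-point support and would not change the Donsker-Varadhan value.
  have hfμ : Integrable (fun p : α × ℝ => s p.1 * p.2) (ρ.map (fun p => (p.1, s p.1 + p.2))) := by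
    rw [integrable_map_measure (by fun_prop) (by fun_prop), hcomp]
    exact hi1.add hi2
  have hval : ∫ p : α × ℝ, s p.1 * p.2 ∂(ρ.map (fun p => (p.1, s p.1 + p.2))) = c ^ 2 := by
    rw [integral_map (by fun_prop) (by fun_prop)]
    calc _ = ∫ p : α × ℝ, (s p.1 * p.2 + s p.1 ^ 2) ∂ρ := by
          congr 1
      _ = _ := by
        rw [integral_add hi1 hi2, integral_prod_mul (μ := L) (ν := gaussianReal 0 1) s (fun z => z),
          integral_id_gaussianReal, integral_fun_fst (f := fun x => s x ^ 2), probReal_univ,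
          one_smul, mul_zero, zero_add, (integral_twoPoint a b (fun x => s x ^ 2) :), ha, hb]
        ring
  have hgauss : ∀ m d : ℝ, ∫⁻ z, ENNReal.ofReal (Real.exp (m * (d + z))) ∂gaussianReal 0 1 =
      ENNReal.ofReal (Real.exp (m * d + m ^ 2 / 2)) := by
    intro m d
    rw [← ofReal_integral_eq_lintegral_ofReal]
    · simp_rw [mul_add, Real.exp_add]
      rw [integral_const_mul]
      have h := congrFun (mgf_fun_id_gaussianReal (μ := 0) (v := 1)) m
      simp only [mgf] at h
      rw [h]
      simp
    · simp_rw [mul_add, Real.exp_add]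
      exact (integrable_exp_mul_gaussianReal m).const_mul _
    · exact ae_of_all _ fun z => (Real.exp_pos _).le
  -- Under the product law the input and the signal inside the output are independent, so their
  -- product is `±c²` with equal odds, whence `cosh`; the noise contributes `exp (c² / 2)`.
  have hlint : ∫⁻ p : α × ℝ, ENNReal.ofReal (Real.exp (s p.1 * p.2))
      ∂(L.prod (ρ.map (fun p => s p.1 + p.2))) =
      ENNReal.ofReal (Real.exp (c ^ 2 / 2) * Real.cosh (c ^ 2)) := by
    have hx : ∀ m : ℝ, ∫⁻ y, ENNReal.ofReal (Real.exp (m * y)) ∂(ρ.map (fun p => s p.1 + p.2)) =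
        2⁻¹ * (ENNReal.ofReal (Real.exp (m * c + m ^ 2 / 2)) +
          ENNReal.ofReal (Real.exp (m * -c + m ^ 2 / 2))) := by
      intro m
      rw [lintegral_map (by fun_prop) (by fun_prop), lintegral_prod _ (by fun_prop)]
      simp only [hgauss]
      rw [lintegral_twoPoint _ _ (by fun_prop), ha, hb]
    rw [lintegral_prod _ (by fun_prop)]
    simp only [hx]
    rw [lintegral_twoPoint _ _ (by fun_prop), ha, hb]
    have h2 : (2⁻¹ : ℝ≥0∞) = ENNReal.ofReal 2⁻¹ := by
      rw [ENNReal.ofReal_inv_of_pos two_pos]; simp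
    rw [h2, ← ENNReal.ofReal_add (by positivity) (by positivity),
      ← ENNReal.ofReal_add (by positivity) (by positivity),
      ← ENNReal.ofReal_mul (by positivity), ← ENNReal.ofReal_mul (by positivity),
      ← ENNReal.ofReal_add (by positivity) (by positivity), ← ENNReal.ofReal_mul (by positivity)]
    congr 1
    rw [Real.cosh_eq, neg_mul_neg, neg_sq, mul_neg, neg_mul]
    simp only [Real.exp_add, ← sq]
    ring
  have hfν : Integrable (fun p : α × ℝ => Real.exp (s p.1 * p.2))
      (L.prod (ρ.map (fun p => s p.1 + p.2))) := by
    apply (lintegral_ofReal_ne_top_iff_integrable (by fun_prop)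
      (ae_of_all _ fun p => (Real.exp_pos _).le)).1
    rw [hlint]
    exact ENNReal.ofReal_ne_top
  have hexp : ∫ p : α × ℝ, Real.exp (s p.1 * p.2) ∂(L.prod (ρ.map (fun p => s p.1 + p.2))) =
      Real.exp (c ^ 2 / 2) * Real.cosh (c ^ 2) := by
    rw [integral_eq_lintegral_of_nonneg_ae (ae_of_all _ fun p => (Real.exp_pos _).le)
      (by fun_prop), hlint, ENNReal.toReal_ofReal (by positivity)]
  refine le_trans (ENNReal.ofReal_le_ofReal ?_)
    (ofReal_integral_sub_log_integral_exp_le_klDiv hfμ hfν)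
  rw [hval, hexp, Real.log_mul (Real.exp_pos _).ne' (Real.cosh_pos _).ne', Real.log_exp]
  have h : Real.log (Real.cosh (c ^ 2)) ≤ (c ^ 2) ^ 2 / 2 := by
    rw [Real.log_le_iff_le_exp (Real.cosh_pos _)]
    exact Real.cosh_le_exp_half_sq _
  nlinarith [h]

end AdditiveNoise

/-- Mutual information does not increase when a part of the observation is discarded. -/
lemma mutualInfo_fst_le {Ω α β γ : Type*} [MeasurableSpace Ω] [MeasurableSpace α]
    [MeasurableSpace β] [MeasurableSpace γ] (P : Measure Ω) [IsProbabilityMeasure P] {X : Ω → α}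
    {Y : Ω → β} {Y' : Ω → γ} (hX : Measurable X) (hY : Measurable Y) (hY' : Measurable Y') :
    mutualInfo P X Y ≤ mutualInfo P X (fun ω => (Y ω, Y' ω)) := by
  unfold mutualInfo
  gcongr
  have := Measure.isProbabilityMeasure_map (μ := P) hX.aemeasurable
  have := Measure.isProbabilityMeasure_map (μ := P) (hY.prodMk hY').aemeasurable
  have := Measure.isProbabilityMeasure_map (μ := P) (hX.prodMk (hY.prodMk hY')).aemeasurable
  have h := klDiv_map_le (P.map (fun ω => (X ω, (Y ω, Y' ω))))
    ((P.map X).prod (P.map (fun ω => (Y ω, Y' ω))))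
    (measurable_id.prodMap measurable_fst : Measurable (Prod.map (id : α → α) (Prod.fst : β × γ → β)))
  rwa [← Measure.map_prod_map _ _ measurable_id measurable_fst, Measure.map_id,
    Measure.map_map measurable_fst (by fun_prop), Measure.map_map (by fun_prop) (by fun_prop)] at h

/-! ### Bounds for the DDF rate -/

/-- From `log (1 + u) ≤ u`: the bound depends on the energy `a`, not on the slot length. -/
lemma mul_gaussC_div_le {t a : ℝ} (ht : 0 ≤ t) (ha : 0 ≤ a) :
    t * gaussC (a / t) ≤ a / (2 * Real.log 2) := by
  have hl : 0 < Real.log 2 := Real.log_pos one_lt_two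
  rcases ht.eq_or_lt with rfl | ht
  · simp only [zero_mul]; positivity
  have h : Real.log (1 + a / t) ≤ a / t := by
    have := Real.log_le_sub_one_of_pos (x := 1 + a / t) (by positivity)
    linarith
  calc t * gaussC (a / t) = t * Real.log (1 + a / t) / (2 * Real.log 2) := by
        rw [gaussC, Real.logb]; ring
    _ ≤ t * (a / t) / (2 * Real.log 2) := by gcongr
    _ = _ := by rw [mul_div_cancel₀ _ ht.ne']

/-- Splitting powers between incoherent and coherent transmission does not increase the received
power beyond that of fully coherent transmission. -/
lemma coherent_power_split_le {a b x x' y y' : ℝ} (ha : 0 ≤ a) (hb : 0 ≤ b) (hx : 0 ≤ x)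
    (hx' : 0 ≤ x') (hy : 0 ≤ y) (hy' : 0 ≤ y') :
    a ^ 2 * x + b ^ 2 * y + (a * √x' + b * √y') ^ 2 ≤ (a * √(x + x') + b * √(y + y')) ^ 2 := by
  -- The squares add up exactly; only the cross term needs an inequality.
  have h : a * b * (√x' * √y') ≤ a * b * (√(x + x') * √(y + y')) := by
    gcongr <;> linarith
  linarith [congrArg (a ^ 2 * ·) (Real.sq_sqrt hx'), congrArg (b ^ 2 * ·) (Real.sq_sqrt hy'),
    congrArg (a ^ 2 * ·) (Real.sq_sqrt (add_nonneg hx hx')),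
    congrArg (b ^ 2 * ·) (Real.sq_sqrt (add_nonneg hy hy')),
    show (a * √x' + b * √y') ^ 2 = a ^ 2 * √x' ^ 2 + b ^ 2 * √y' ^ 2 + 2 * (a * b * (√x' * √y')) by
      ring,
    show (a * √(x + x') + b * √(y + y')) ^ 2 = a ^ 2 * √(x + x') ^ 2 + b ^ 2 * √(y + y') ^ 2 +
      2 * (a * b * (√(x + x') * √(y + y'))) by ring,
    show a ^ 2 * (x + x') = a ^ 2 * x + a ^ 2 * x' by ring,
    show b ^ 2 * (y + y') = b ^ 2 * y + b ^ 2 * y' by ring]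

/-- The sum-rate constraint alone suffices: moving relay 1's private power to the common message
only increases the coherent energy. -/
lemma DDFFeasible.rate_le {g : Gains} {P : Powers} {p : DDFParams} (h : DDFFeasible g P p)
    (h13 : 0 ≤ g.h13) (h23 : 0 ≤ g.h23) (hP2 : 0 ≤ P.P2) :
    p.Rp + p.Rc ≤ (g.h13 * √P.P1 + g.h23 * √P.P2) ^ 2 / (2 * Real.log 2) := by
  have hl : 0 < Real.log 2 := Real.log_pos one_lt_two
  have hp := h.P1p_nonneg
  refine h.sum_rate.trans ((mul_gaussC_div_le h.t4_nonneg (by positivity)).trans ?_)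
  have hs := coherent_power_split_le h13 h23 hp h.P1c_nonneg le_rfl hP2
  rw [h.power1, zero_add, mul_zero, add_zero] at hs
  gcongr

lemma bddAbove_ddfRates {g : Gains} {P : Powers} (h13 : 0 ≤ g.h13) (h23 : 0 ≤ g.h23)
    (hP2 : 0 ≤ P.P2) : BddAbove {R | ∃ p : DDFParams, DDFFeasible g P p ∧ R = p.Rp + p.Rc} := by
  refine ⟨(g.h13 * √P.P1 + g.h23 * √P.P2) ^ 2 / (2 * Real.log 2), ?_⟩
  rintro _ ⟨p, hp, rfl⟩
  exact hp.rate_le h13 h23 hP2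

lemma ddfRate_le {g : Gains} {P : Powers} (h13 : 0 ≤ g.h13) (h23 : 0 ≤ g.h23) (hP2 : 0 ≤ P.P2) :
    ddfRate g P ≤ (g.h13 * √P.P1 + g.h23 * √P.P2) ^ 2 / (2 * Real.log 2) := by
  have hl : 0 < Real.log 2 := Real.log_pos one_lt_two
  apply Real.sSup_le
  · rintro _ ⟨p, hp, rfl⟩
    exact hp.rate_le h13 h23 hP2
  · positivity

/-- The parameters of the DDF scheme with slots of equal duration and only a common message. -/
noncomputable def commonHalfParams (P : Powers) (R : ℝ) : DDFParams :=
  ⟨1 / 2, 1 / 2, 0, P.P0, 0, P.P1, 0, R⟩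

/-- Halving each slot doubles the power within it, hence the factor 2. The sum-rate constraint holds
with equality, and `hle` makes the broadcast constraint weaker. -/
lemma ddfFeasible_commonHalfParams {g : Gains} {P : Powers} (hP0 : 0 ≤ P.P0) (hP1 : 0 ≤ P.P1)
    (hle : (g.h13 * √P.P1 + g.h23 * √P.P2) ^ 2 ≤ g.h02 ^ 2 * P.P0) :
    DDFFeasible g P (commonHalfParams P
      (1 / 2 * gaussC (2 * (g.h13 * √P.P1 + g.h23 * √P.P2) ^ 2))) := by
  have hC : ∀ {x y : ℝ}, 0 ≤ x → x ≤ y → gaussC x ≤ gaussC y := by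
    intro x y hx hxy
    unfold gaussC
    have := Real.logb_le_logb_of_le (b := 2) one_lt_two (x := 1 + x) (y := 1 + y) (by linarith)
      (by linarith)
    linarith
  have h0 : gaussC 0 = 0 := by simp [gaussC]
  have hnn : 0 ≤ gaussC (2 * (g.h13 * √P.P1 + g.h23 * √P.P2) ^ 2) :=
    h0 ▸ hC le_rfl (by positivity)
  constructor <;> simp only [commonHalfParams] <;> try norm_num
  · exact hP0
  · exact hP1
  · exact hnn
  · simp [h0]
  · exact hC (by positivity) (by linarith)
  · exact (congrArg gaussC (by ring)).le

lemma le_ddfCommonHalfRate {g : Gains} {P : Powers} (h13 : 0 ≤ g.h13) (h23 : 0 ≤ g.h23)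
    (hP0 : 0 ≤ P.P0) (hP1 : 0 ≤ P.P1) (hP2 : 0 ≤ P.P2)
    (hle : (g.h13 * √P.P1 + g.h23 * √P.P2) ^ 2 ≤ g.h02 ^ 2 * P.P0) :
    1 / 2 * gaussC (2 * (g.h13 * √P.P1 + g.h23 * √P.P2) ^ 2) ≤ ddfCommonHalfRate g P := by
  refine le_csSup ((bddAbove_ddfRates h13 h23 hP2).mono ?_)
    ⟨_, ddfFeasible_commonHalfParams hP0 hP1 hle, rfl, rfl, rfl, rfl, rfl, ?_⟩
  · rintro _ ⟨p, hp, -, -, -, -, -, rfl⟩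
    exact ⟨p, hp, rfl⟩
  · simp [commonHalfParams]

lemma ddfCommonHalfRate_le_ddfRate {g : Gains} {P : Powers} (h13 : 0 ≤ g.h13) (h23 : 0 ≤ g.h23)
    (hP0 : 0 ≤ P.P0) (hP1 : 0 ≤ P.P1) (hP2 : 0 ≤ P.P2)
    (hle : (g.h13 * √P.P1 + g.h23 * √P.P2) ^ 2 ≤ g.h02 ^ 2 * P.P0) :
    ddfCommonHalfRate g P ≤ ddfRate g P := by
  -- Comparing real suprema requires a point in the smaller set; `hle` provides it.
  refine csSup_le_csSup (bddAbove_ddfRates h13 h23 hP2)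
    ⟨_, _, ddfFeasible_commonHalfParams hP0 hP1 hle, rfl, rfl, rfl, rfl, rfl, rfl⟩ ?_
  rintro _ ⟨p, hp, -, -, -, -, -, rfl⟩
  exact ⟨p, hp, rfl⟩

/-- Uses `log (1 + u) ≥ 1 - 1 / (1 + u) ≥ u (1 - u)` at `u = 2x`. The form matches the lower bound
on the cut-set side. -/
lemma half_mul_gaussC_ge {x : ℝ} (hx : 0 ≤ x) :
    x / (2 * Real.log 2) * (1 - 2 * x) ≤ 1 / 2 * gaussC (2 * x) := by
  have hl : 0 < Real.log 2 := Real.log_pos one_lt_two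
  have h : 2 * x * (1 - 2 * x) ≤ Real.log (1 + 2 * x) := by
    refine le_trans ?_ (Real.one_sub_inv_le_log_of_pos (by positivity))
    rw [← sub_nonneg]
    have : 1 - (1 + 2 * x)⁻¹ - 2 * x * (1 - 2 * x) = 8 * x ^ 3 / (1 + 2 * x) := by
      field_simp
      ring
    rw [this]
    positivity
  calc x / (2 * Real.log 2) * (1 - 2 * x) = 2 * x * (1 - 2 * x) / (4 * Real.log 2) := by
        field_simp; ring
    _ ≤ Real.log (1 + 2 * x) / (4 * Real.log 2) := by gcongr
    _ = _ := by rw [gaussC, Real.logb]; field_simp; ring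

/-! ### Bounds for the cut-set bound -/

/-- The second moment of a linear combination, by the Cauchy-Schwarz inequality. -/
lemma integral_sq_linear_comb_le (L : Measure (ℝ × ℝ)) {a b : ℝ} (ha : 0 ≤ a) (hb : 0 ≤ b)
    (h1 : Integrable (fun x => x.1 ^ 2) L) (h2 : Integrable (fun x => x.2 ^ 2) L) :
    Integrable (fun x => (a * x.1 + b * x.2) ^ 2) L ∧
      ∫ x, (a * x.1 + b * x.2) ^ 2 ∂L ≤ (a * √(∫ x, x.1 ^ 2 ∂L) + b * √(∫ x, x.2 ^ 2 ∂L)) ^ 2 := by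
  have m1 : MemLp (fun x : ℝ × ℝ => x.1) 2 L :=
    (memLp_two_iff_integrable_sq (by fun_prop)).2 h1
  have m2 : MemLp (fun x : ℝ × ℝ => x.2) 2 L :=
    (memLp_two_iff_integrable_sq (by fun_prop)).2 h2
  have h12 : Integrable (fun x : ℝ × ℝ => x.1 * x.2) L := m1.integrable_mul m2
  have hexp : ∀ c d : ℝ, Integrable (fun x => (c * x.1 + d * x.2) ^ 2) L ∧
      ∫ x, (c * x.1 + d * x.2) ^ 2 ∂L = c ^ 2 * (∫ x, x.1 ^ 2 ∂L) +
        2 * c * d * (∫ x, x.1 * x.2 ∂L) + d ^ 2 * ∫ x, x.2 ^ 2 ∂L := by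
    intro c d
    have he : (fun x : ℝ × ℝ => (c * x.1 + d * x.2) ^ 2) =
        fun x => c ^ 2 * x.1 ^ 2 + 2 * c * d * (x.1 * x.2) + d ^ 2 * x.2 ^ 2 := by
      ext x; ring
    have i1 := h1.const_mul (c ^ 2)
    have i2 := h12.const_mul (2 * c * d)
    have i3 := h2.const_mul (d ^ 2)
    have i12 : Integrable (fun x : ℝ × ℝ => c ^ 2 * x.1 ^ 2 + 2 * c * d * (x.1 * x.2)) L :=
      i1.add i2
    rw [he]
    refine ⟨i12.add i3, ?_⟩
    rw [integral_add i12 i3, integral_add i1 i2, integral_const_mul, integral_const_mul,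
      integral_const_mul]
  have hA : 0 ≤ ∫ x, x.1 ^ 2 ∂L := integral_nonneg fun x => sq_nonneg _
  have hB : 0 ≤ ∫ x, x.2 ^ 2 ∂L := integral_nonneg fun x => sq_nonneg _
  -- The quadratic `t ↦ E[(t X₁ + X₂)²]` is nonnegative, so its discriminant is not positive.
  have hCS : (∫ x, x.1 * x.2 ∂L) ^ 2 ≤ (∫ x, x.1 ^ 2 ∂L) * ∫ x, x.2 ^ 2 ∂L := by
    have hd := discrim_le_zero (a := ∫ x, x.1 ^ 2 ∂L) (b := 2 * ∫ x, x.1 * x.2 ∂L)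
      (c := ∫ x, x.2 ^ 2 ∂L) (fun t => by
        have h0 : 0 ≤ ∫ x, (t * x.1 + 1 * x.2) ^ 2 ∂L := integral_nonneg fun x => sq_nonneg _
        rw [(hexp t 1).2] at h0
        linarith)
    rw [discrim] at hd
    linarith
  have hC : ∫ x, x.1 * x.2 ∂L ≤ √(∫ x, x.1 ^ 2 ∂L) * √(∫ x, x.2 ^ 2 ∂L) := by
    rw [← Real.sqrt_mul hA]
    exact Real.le_sqrt_of_sq_le hCS
  refine ⟨(hexp a b).1, ?_⟩
  rw [(hexp a b).2, add_sq, mul_pow, mul_pow, Real.sq_sqrt hA, Real.sq_sqrt hB]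
  have := mul_le_mul_of_nonneg_left hC (by positivity : 0 ≤ 2 * a * b)
  linarith

lemma CutSetInput.Admissible.cut012_le {g : Gains} {P : Powers} {q : CutSetInput} (hq : q.Admissible P)
    (h13 : 0 ≤ g.h13) (h23 : 0 ≤ g.h23) :
    q.cut012 g ≤ ENNReal.ofReal ((g.h13 * √P.P1 + g.h23 * √P.P2) ^ 2 / (2 * Real.log 2)) := by
  have hl : 0 < Real.log 2 := Real.log_pos one_lt_two
  obtain ⟨i4, c4⟩ := integral_sq_linear_comb_le (q.law4 : Measure (ℝ × ℝ)) h13 h23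
    hq.integrable4.1 hq.integrable4.2
  set A1 := ∫ x, x.2 ^ 2 ∂(q.law1 : Measure (ℝ × ℝ))
  set A2 := ∫ x, x.2 ^ 2 ∂(q.law2 : Measure (ℝ × ℝ))
  set A4 := ∫ x, x.1 ^ 2 ∂(q.law4 : Measure (ℝ × ℝ))
  set B4 := ∫ x, x.2 ^ 2 ∂(q.law4 : Measure (ℝ × ℝ))
  set V4 := ∫ x, (g.h13 * x.1 + g.h23 * x.2) ^ 2 ∂(q.law4 : Measure (ℝ × ℝ))
  have hA1 : 0 ≤ A1 := integral_nonneg fun x => sq_nonneg _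
  have hA2 : 0 ≤ A2 := integral_nonneg fun x => sq_nonneg _
  have hA4 : 0 ≤ A4 := integral_nonneg fun x => sq_nonneg _
  have hB4 : 0 ≤ B4 := integral_nonneg fun x => sq_nonneg _
  have hV4 : 0 ≤ V4 := integral_nonneg fun x => sq_nonneg _
  have ht1 := hq.t1_nonneg
  have ht2 := hq.t2_nonneg
  have ht4 := hq.t4_nonneg
  have hrelay : ∀ (L : ProbabilityMeasure (ℝ × ℝ)) (c : ℝ),
      Integrable (fun x => x.2 ^ 2) (L : Measure (ℝ × ℝ)) →
      mutualInfo ((L : Measure (ℝ × ℝ)).prod noise₂) (fun ω => ω.1.2)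
        (fun ω => c * ω.1.2 + ω.2.2) ≤
      ENNReal.ofReal (c ^ 2 * (∫ x, x.2 ^ 2 ∂(L : Measure (ℝ × ℝ))) / (2 * Real.log 2)) := by
    intro L c hi
    have : IsProbabilityMeasure ((L : Measure (ℝ × ℝ)).map Prod.snd) :=
      Measure.isProbabilityMeasure_map (by fun_prop)
    have h := mutualInfo_add_noise_le (P := (L : Measure (ℝ × ℝ)).prod noise₂)
      (X := fun ω => ω.1.2) (Z := fun ω => ω.2.2) ((L : Measure (ℝ × ℝ)).map Prod.snd)
      (s := fun x => c * x) (by fun_prop)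
      (by
        rw [integrable_map_measure (by fun_prop) (by fun_prop)]
        simpa [Function.comp_def, mul_pow] using hi.const_mul (c ^ 2))
      (by fun_prop) (by fun_prop)
      (by
        have h := Measure.map_prod_map (L : Measure (ℝ × ℝ)) noise₂
          (measurable_snd : Measurable (Prod.snd : ℝ × ℝ → ℝ))
          (measurable_snd : Measurable (Prod.snd : ℝ × ℝ → ℝ))
        rw [show noise₂.map Prod.snd = gaussianReal 0 1 from Measure.snd_prod] at h
        rw [h]; rfl)
    refine h.trans (le_of_eq ?_)
    rw [← ENNReal.ofReal_div_of_pos hl, integral_map (by fun_prop) (by fun_prop)]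
    simp_rw [mul_pow]
    rw [integral_const_mul, div_div]
  have m1 := hrelay q.law1 g.h23 hq.integrable1.2
  have m2 := hrelay q.law2 g.h13 hq.integrable2.2
  have m4 : mutualInfo q.prob4 (fun ω => ω.1) g.y43 ≤ ENNReal.ofReal (V4 / (2 * Real.log 2)) := by
    have h := mutualInfo_add_noise_le (P := q.prob4) (X := fun ω => ω.1) (Z := fun ω => ω.2)
      (q.law4 : Measure (ℝ × ℝ)) (s := fun x => g.h13 * x.1 + g.h23 * x.2) (by fun_prop) i4
      (by fun_prop) (by fun_prop) Measure.map_id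
    refine h.trans (le_of_eq ?_)
    rw [← ENNReal.ofReal_div_of_pos hl, div_div]
  calc q.cut012 g ≤ ENNReal.ofReal q.t1 * ENNReal.ofReal (g.h23 ^ 2 * A1 / (2 * Real.log 2)) +
        ENNReal.ofReal q.t2 * ENNReal.ofReal (g.h13 ^ 2 * A2 / (2 * Real.log 2)) +
        ENNReal.ofReal q.t4 * ENNReal.ofReal (V4 / (2 * Real.log 2)) := by
        unfold CutSetInput.cut012
        gcongr
        · exact m1
        · exact m2
    _ = ENNReal.ofReal ((g.h13 ^ 2 * (q.t2 * A2) + g.h23 ^ 2 * (q.t1 * A1) + q.t4 * V4) /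
          (2 * Real.log 2)) := by
        rw [← ENNReal.ofReal_mul ht1, ← ENNReal.ofReal_mul ht2, ← ENNReal.ofReal_mul ht4,
          ← ENNReal.ofReal_add (by positivity) (by positivity),
          ← ENNReal.ofReal_add (by positivity) (by positivity)]
        congr 1
        ring
    _ ≤ _ := by
        apply ENNReal.ofReal_le_ofReal
        gcongr
        rw [← hq.power1, ← hq.power2]
        -- The relay energies in states 2 and 1 play the incoherent part, those in state 4 the
        -- coherent part.
        refine le_trans ?_ (coherent_power_split_le h13 h23 (mul_nonneg ht2 hA2)
          (mul_nonneg ht4 hA4) (mul_nonneg ht1 hA1) (mul_nonneg ht4 hB4))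
        rw [Real.sqrt_mul ht4, Real.sqrt_mul ht4]
        have h := mul_le_mul_of_nonneg_left c4 ht4
        have h' : q.t4 * (g.h13 * √A4 + g.h23 * √B4) ^ 2 =
            (g.h13 * (√q.t4 * √A4) + g.h23 * (√q.t4 * √B4)) ^ 2 := by
          conv_lhs => rw [← Real.sq_sqrt ht4]
          ring
        linarith

lemma cutSetBound_le {g : Gains} {P : Powers} (h13 : 0 ≤ g.h13) (h23 : 0 ≤ g.h23) :
    cutSetBound g P ≤
      ENNReal.ofReal ((g.h13 * √P.P1 + g.h23 * √P.P2) ^ 2 / (2 * Real.log 2)) :=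
  iSup₂_le fun _ hq => (min_le_right _ _).trans ((min_le_right _ _).trans (hq.cut012_le h13 h23))

/-- Antipodal signals, broadcast by the source during one half of the time and sent coherently by
the relays during the other half. -/
noncomputable def antipodalInput (P : Powers) : CutSetInput where
  t1 := 0
  t2 := 0
  t3 := 1 / 2
  t4 := 1 / 2
  -- States of duration zero cost no power, so their laws are arbitrary.
  law1 := ⟨Measure.dirac 0, inferInstance⟩
  law2 := ⟨Measure.dirac 0, inferInstance⟩
  -- The factor 2 compensates for transmitting only half of the time.
  law3 := ⟨twoPoint (√(2 * P.P0)) (-√(2 * P.P0)), inferInstance⟩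
  law4 := ⟨twoPoint (√(2 * P.P1), √(2 * P.P2)) (-√(2 * P.P1), -√(2 * P.P2)), inferInstance⟩

lemma admissible_antipodalInput {P : Powers} (hP0 : 0 ≤ P.P0) (hP1 : 0 ≤ P.P1) (hP2 : 0 ≤ P.P2) :
    (antipodalInput P).Admissible P where
  t1_nonneg := le_rfl
  t2_nonneg := le_rfl
  t3_nonneg := by norm_num [antipodalInput]
  t4_nonneg := by norm_num [antipodalInput]
  time := by norm_num [antipodalInput]
  integrable1 := ⟨integrable_dirac (by simp), integrable_dirac (by simp)⟩
  integrable2 := ⟨integrable_dirac (by simp), integrable_dirac (by simp)⟩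
  integrable3 := integrable_twoPoint _ _ _
  integrable4 := ⟨integrable_twoPoint _ _ _, integrable_twoPoint _ _ _⟩
  power0 := by
    simp only [antipodalInput, ProbabilityMeasure.coe_mk, integral_twoPoint, neg_sq,
      Real.sq_sqrt (mul_nonneg zero_le_two hP0)]
    ring
  power1 := by
    simp only [antipodalInput, ProbabilityMeasure.coe_mk, integral_twoPoint, neg_sq,
      Real.sq_sqrt (mul_nonneg zero_le_two hP1)]
    ring
  power2 := by
    simp only [antipodalInput, ProbabilityMeasure.coe_mk, integral_twoPoint, neg_sq,
      Real.sq_sqrt (mul_nonneg zero_le_two hP2)]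
    ring

/-- One term suffices in each cut: state 3 for the first three, state 4 for the last. -/
lemma le_cutSetBound {g : Gains} {P : Powers} {x : ℝ} (hP0 : 0 ≤ P.P0) (hP1 : 0 ≤ P.P1)
    (hP2 : 0 ≤ P.P2) (hx : x = (g.h13 * √P.P1 + g.h23 * √P.P2) ^ 2)
    (h1 : x ≤ g.h01 ^ 2 * P.P0) (h2 : x ≤ g.h02 ^ 2 * P.P0)
    (h1' : g.h01 ^ 2 * P.P0 ≤ 1 / 4) (h2' : g.h02 ^ 2 * P.P0 ≤ 1 / 4) :
    ENNReal.ofReal (x / (2 * Real.log 2) * (1 - 2 * x)) ≤ cutSetBound g P := by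
  have hl : 0 < Real.log 2 := Real.log_pos one_lt_two
  have hx0 : 0 ≤ x := by rw [hx]; positivity
  have hval : ENNReal.ofReal (x / (2 * Real.log 2) * (1 - 2 * x)) =
      ENNReal.ofReal (1 / 2) *
        (ENNReal.ofReal ((2 * x) / 2 - (2 * x) ^ 2 / 2) / ENNReal.ofReal (Real.log 2)) := by
    rw [← ENNReal.ofReal_div_of_pos hl, ← ENNReal.ofReal_mul (by norm_num)]
    congr 1
    field_simp
  -- The map `y ↦ y - 2y²` increases only up to `1/4`, which is why the source energies are capped
  -- there.
  have hmono : ∀ {y : ℝ}, x ≤ y → y ≤ 1 / 4 →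
      2 * x / 2 - (2 * x) ^ 2 / 2 ≤ 2 * y / 2 - (2 * y) ^ 2 / 2 := by
    intro y hxy hy
    nlinarith
  set q := antipodalInput P with hq
  have hnoise1 : noise₂.map Prod.fst = gaussianReal 0 1 := Measure.fst_prod
  have hnoise2 : noise₂.map Prod.snd = gaussianReal 0 1 := Measure.snd_prod
  have hsource : ∀ (h : ℝ) (Z : ℝ × ℝ → ℝ), Measurable Z → noise₂.map Z = gaussianReal 0 1 →
      x ≤ h ^ 2 * P.P0 → h ^ 2 * P.P0 ≤ 1 / 4 →
      ENNReal.ofReal ((2 * x) / 2 - (2 * x) ^ 2 / 2) / ENNReal.ofReal (Real.log 2) ≤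
        mutualInfo q.prob3 (fun ω => ω.1) (fun ω => h * ω.1 + Z ω.2) := by
    intro h Z hZ hlaw hxh hh
    have hle := le_mutualInfo_add_noise_twoPoint (P := q.prob3) (X := fun ω => ω.1)
      (Z := fun ω => Z ω.2) (a := √(2 * P.P0)) (b := -√(2 * P.P0)) (s := fun y => h * y)
      (c := h * √(2 * P.P0)) (by fun_prop) rfl (by ring) (by fun_prop) (by fun_prop)
      (by
        have h := Measure.map_prod_map (q.law3 : Measure ℝ) noise₂ measurable_id hZ
        rw [hlaw, Measure.map_id] at h
        rw [hq, antipodalInput] at h ⊢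
        exact h.symm)
    refine le_trans (ENNReal.div_le_div_right (ENNReal.ofReal_le_ofReal ?_) _) hle
    have hc : (h * √(2 * P.P0)) ^ 2 = 2 * (h ^ 2 * P.P0) := by
      rw [mul_pow, Real.sq_sqrt (by positivity)]; ring
    rw [show (h * √(2 * P.P0)) ^ 4 = ((h * √(2 * P.P0)) ^ 2) ^ 2 by ring, hc]
    exact hmono hxh hh
  have hrelay : ENNReal.ofReal ((2 * x) / 2 - (2 * x) ^ 2 / 2) / ENNReal.ofReal (Real.log 2) ≤
      mutualInfo q.prob4 (fun ω => ω.1) g.y43 := by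
    have hle := le_mutualInfo_add_noise_twoPoint (P := q.prob4) (X := fun ω => ω.1)
      (Z := fun ω => ω.2) (a := (√(2 * P.P1), √(2 * P.P2))) (b := (-√(2 * P.P1), -√(2 * P.P2)))
      (s := fun y => g.h13 * y.1 + g.h23 * y.2)
      (c := g.h13 * √(2 * P.P1) + g.h23 * √(2 * P.P2)) (by fun_prop) rfl (by ring)
      (by fun_prop) (by fun_prop) Measure.map_id
    refine le_trans (ENNReal.div_le_div_right (ENNReal.ofReal_le_ofReal ?_) _) hle
    have hc : (g.h13 * √(2 * P.P1) + g.h23 * √(2 * P.P2)) ^ 2 = 2 * x := by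
      rw [hx, Real.sqrt_mul zero_le_two, Real.sqrt_mul zero_le_two,
        show g.h13 * (√2 * √P.P1) + g.h23 * (√2 * √P.P2) = √2 * (g.h13 * √P.P1 + g.h23 * √P.P2) by
          ring, mul_pow, Real.sq_sqrt zero_le_two]
    rw [show (g.h13 * √(2 * P.P1) + g.h23 * √(2 * P.P2)) ^ 4 =
      ((g.h13 * √(2 * P.P1) + g.h23 * √(2 * P.P2)) ^ 2) ^ 2 by ring, hc]
  have hy1 := hsource g.h01 Prod.fst measurable_fst hnoise1 h1 h1'
  have hy2 := hsource g.h02 Prod.snd measurable_snd hnoise2 h2 h2'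
  have hm1 : Measurable g.y31 := by unfold Gains.y31; fun_prop
  have hm2 : Measurable g.y32 := by unfold Gains.y32; fun_prop
  refine le_trans ?_ (le_iSup₂ (f := fun (q : CutSetInput) (_ : q.Admissible P) =>
    min (min (q.cut0 g) (q.cut01 g)) (min (q.cut02 g) (q.cut012 g))) q
      (admissible_antipodalInput hP0 hP1 hP2))
  rw [hval]
  refine le_min (le_min ?_ ?_) (le_min ?_ ?_)
  -- This cut sees both relays' outputs; relay 1's alone is enough.
  · exact le_add_of_le_right (mul_le_mul_right
      (hy1.trans (mutualInfo_fst_le q.prob3 measurable_fst hm1 hm2)) _)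
  · exact le_add_of_le_left (le_add_of_le_right (mul_le_mul_right hy2 _))
  · exact le_add_of_le_left (le_add_of_le_right (mul_le_mul_right hy1 _))
  · exact le_add_of_le_right (mul_le_mul_right hrelay _)

/-! ### The low-power limit -/

/-- The ratio is squeezed between `1 - c p` and `(1 - c p)⁻¹`. -/
lemma tendsto_div_of_first_order {a b : ℝ → ℝ} {k c : ℝ} (hk : 0 < k)
    (ha : ∀ᶠ p in 𝓝[>] 0, k * p * (1 - c * p) ≤ a p ∧ a p ≤ k * p)
    (hb : ∀ᶠ p in 𝓝[>] 0, k * p * (1 - c * p) ≤ b p ∧ b p ≤ k * p) :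
    Tendsto (fun p => a p / b p) (𝓝[>] 0) (𝓝 1) := by
  have hlim : Tendsto (fun p : ℝ => 1 - c * p) (𝓝[>] 0) (𝓝 1) := by
    have h : Tendsto (fun p : ℝ => 1 - c * p) (𝓝 0) (𝓝 (1 - c * 0)) :=
      Continuous.tendsto (by fun_prop) 0
    rw [mul_zero, sub_zero] at h
    exact h.mono_left nhdsWithin_le_nhds
  have hinv : Tendsto (fun p : ℝ => (1 - c * p)⁻¹) (𝓝[>] 0) (𝓝 1) := by
    simpa using hlim.inv₀ one_ne_zero
  have hpos : ∀ᶠ p : ℝ in 𝓝[>] 0, 0 < 1 - c * p := hlim.eventually (lt_mem_nhds one_pos)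
  refine tendsto_of_tendsto_of_tendsto_of_le_of_le' hlim hinv ?_ ?_
  · filter_upwards [ha, hb, hpos, self_mem_nhdsWithin] with p h1 h2 h3 (h4 : 0 < p)
    have hbp : 0 < b p := lt_of_lt_of_le (by positivity) h2.1
    rw [le_div_iff₀ hbp]
    nlinarith [mul_le_mul_of_nonneg_left h2.2 h3.le]
  · filter_upwards [ha, hb, hpos, self_mem_nhdsWithin] with p h1 h2 h3 (h4 : 0 < p)
    have hbp : 0 < b p := lt_of_lt_of_le (by positivity) h2.1
    rw [div_le_iff₀ hbp, inv_mul_eq_div, le_div_iff₀ h3]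
    nlinarith [mul_le_mul_of_nonneg_right h1.2 h3.le]

theorem mainTheorem2 (g : Gains) (γ₁ γ₂ : ℝ)
    (h02_nonneg : 0 ≤ g.h02) (h02_le_h01 : g.h02 ≤ g.h01)
    (h13_nonneg : 0 ≤ g.h13) (h23_nonneg : 0 ≤ g.h23)
    (γ₁_nonneg : 0 ≤ γ₁) (γ₂_nonneg : 0 ≤ γ₂)
    (hpos : 0 < g.h13 * √γ₁ + g.h23 * √γ₂)
    (hcond : (g.h13 * √γ₁ + g.h23 * √γ₂) ^ 2 ≤ min (g.h01 ^ 2) (g.h02 ^ 2)) :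
    Tendsto (fun P₀ : ℝ => ddfRate g ⟨P₀, γ₁ * P₀, γ₂ * P₀⟩ /
        (cutSetBound g ⟨P₀, γ₁ * P₀, γ₂ * P₀⟩).toReal) (𝓝[>] 0) (𝓝 1) ∧
      Tendsto (fun P₀ : ℝ => ddfCommonHalfRate g ⟨P₀, γ₁ * P₀, γ₂ * P₀⟩ /
        (cutSetBound g ⟨P₀, γ₁ * P₀, γ₂ * P₀⟩).toReal) (𝓝[>] 0) (𝓝 1) := by
  have hl : 0 < Real.log 2 := Real.log_pos one_lt_two
  set S := (g.h13 * √γ₁ + g.h23 * √γ₂) ^ 2 with hS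
  have hSpos : 0 < S := by positivity
  have hS1 : S ≤ g.h01 ^ 2 := hcond.trans (min_le_left _ _)
  have hS2 : S ≤ g.h02 ^ 2 := hcond.trans (min_le_right _ _)
  have hcoh : ∀ p : ℝ, 0 < p → (g.h13 * √(γ₁ * p) + g.h23 * √(γ₂ * p)) ^ 2 = S * p := by
    intro p hp
    rw [Real.sqrt_mul γ₁_nonneg, Real.sqrt_mul γ₂_nonneg,
      show g.h13 * (√γ₁ * √p) + g.h23 * (√γ₂ * √p) = (g.h13 * √γ₁ + g.h23 * √γ₂) * √p by ring,
      mul_pow, Real.sq_sqrt hp.le]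
  have hk : ∀ p : ℝ, S / (2 * Real.log 2) * p = S * p / (2 * Real.log 2) := fun p => by ring
  have hsmall : ∀ᶠ p : ℝ in 𝓝[>] 0, g.h01 ^ 2 * p < 1 / 4 := by
    have h : Tendsto (fun p : ℝ => g.h01 ^ 2 * p) (𝓝 0) (𝓝 (g.h01 ^ 2 * 0)) :=
      Continuous.tendsto (by fun_prop) 0
    rw [mul_zero] at h
    exact (h.mono_left nhdsWithin_le_nhds).eventually (gt_mem_nhds (by norm_num))
  have hU : ∀ᶠ p : ℝ in 𝓝[>] 0,
      S / (2 * Real.log 2) * p * (1 - 2 * S * p) ≤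
        (cutSetBound g ⟨p, γ₁ * p, γ₂ * p⟩).toReal ∧
      (cutSetBound g ⟨p, γ₁ * p, γ₂ * p⟩).toReal ≤ S / (2 * Real.log 2) * p := by
    filter_upwards [hsmall, self_mem_nhdsWithin] with p h1 (hp : 0 < p)
    have h21 : g.h02 ^ 2 * p ≤ g.h01 ^ 2 * p := by gcongr
    have hup := cutSetBound_le (P := ⟨p, γ₁ * p, γ₂ * p⟩) h13_nonneg h23_nonneg
    have hlo := le_cutSetBound (g := g) (P := ⟨p, γ₁ * p, γ₂ * p⟩) hp.le (by positivity)
      (by positivity) (hcoh p hp).symm (by dsimp only; gcongr) (by dsimp only; gcongr) h1.le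
      (h21.trans h1.le)
    rw [hcoh p hp] at hup
    rw [hk, mul_assoc 2 S p]
    -- The upper bound also gives finiteness, without which `toReal` would return 0.
    exact ⟨(ENNReal.ofReal_le_iff_le_toReal (hup.trans_lt ENNReal.ofReal_lt_top).ne).1 hlo,
      ENNReal.toReal_le_of_le_ofReal (by positivity) hup⟩
  have hD : ∀ p : ℝ, 0 < p → S / (2 * Real.log 2) * p * (1 - 2 * S * p) ≤
        ddfCommonHalfRate g ⟨p, γ₁ * p, γ₂ * p⟩ ∧
      ddfCommonHalfRate g ⟨p, γ₁ * p, γ₂ * p⟩ ≤ ddfRate g ⟨p, γ₁ * p, γ₂ * p⟩ ∧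
      ddfRate g ⟨p, γ₁ * p, γ₂ * p⟩ ≤ S / (2 * Real.log 2) * p := by
    intro p hp
    have hle : (g.h13 * √(γ₁ * p) + g.h23 * √(γ₂ * p)) ^ 2 ≤ g.h02 ^ 2 * p := by
      rw [hcoh p hp]; gcongr
    have hup := ddfRate_le (P := ⟨p, γ₁ * p, γ₂ * p⟩) h13_nonneg h23_nonneg (by positivity)
    have hlo := le_ddfCommonHalfRate (P := ⟨p, γ₁ * p, γ₂ * p⟩) h13_nonneg h23_nonneg hp.le
      (by positivity) (by positivity) hle
    rw [hcoh p hp] at hup hlo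
    rw [hk, mul_assoc 2 S p]
    exact ⟨(half_mul_gaussC_ge (by positivity)).trans hlo,
      ddfCommonHalfRate_le_ddfRate h13_nonneg h23_nonneg hp.le (by positivity) (by positivity) hle,
      hup⟩
  constructor
  · refine tendsto_div_of_first_order (by positivity) ?_ hU
    filter_upwards [self_mem_nhdsWithin] with p hp
    exact ⟨(hD p hp).1.trans (hD p hp).2.1, (hD p hp).2.2⟩
  · refine tendsto_div_of_first_order (by positivity) ?_ hU
    filter_upwards [self_mem_nhdsWithin] with p hp
    exact ⟨(hD p hp).1, (hD p hp).2.1.trans (hD p hp).2.2⟩
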